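/- Let $N\ge 1$ and let $\bar A\in\{0,1\}^{N\times N}$ be the adjacency matrix of the directed $N$-cycle with self-loops: $\bar A_{n,n}=1$ for $1\le n\le N$, $\bar A_{n,n+1}=1$ for $1\le n<N$, $\bar A_{N,1}=1$, and all other entries are $0$. Let $\operatorname{spr}(\bar A)$ be the subspace of all $B\in\mathbb{C}^{N\times N}$ such that $B_{n,l}=0$ whenever $\bar A_{n,l}=0$. A property is said to hold for almost all $T\in\mathbb{C}^{N\times N}$ if the closure of the set of those $T$ for which it fails is nowhere dense in $\mathbb{C}^{N\times N}$ and has Lebesgue measure zero. Then for almost all $T\in\mathbb{C}^{N\times N}$ there are matrices $A_1,\dots,A_N\in\operatorname{spr}(\bar A)$ with $$T=A_N A_{N-1}\cdots A_1 .$$ In other words, almost all $T$ are computable in $N$ distributed steps on the cycle: for almost all $T\in\mathbb{C}^{N\times N}$ there are $A_1,\dots,A_N\in\operatorname{spr}(\bar A)$ such that, for every $z\in\mathbb{C}^N$, the iteration $z(k)=A_k z(k-1)$, $k=1,\dots,N$, started at $z(0)=z$, ends in $z(N)=Tz$. -/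

import Mathlib

open MeasureTheory

/-- The sparsity class `spr(P)`: the subspace of all complex `N × N` matrices that vanish
wherever `P` vanishes. -/
def spr {N : ℕ} (P : Matrix (Fin N) (Fin N) ℂ) : Submodule ℂ (Matrix (Fin N) (Fin N) ℂ) where
  carrier := {Q | ∀ n l, P n l = 0 → Q n l = 0}
  zero_mem' := fun _ _ _ => rfl
  add_mem' := fun {Q R} hQ hR n l h => by
    rw [Matrix.add_apply, hQ n l h, hR n l h, add_zero]
  smul_mem' := fun c Q hQ n l h => by
    rw [Matrix.smul_apply, hQ n l h, smul_zero]

/-- The adjacency matrix of the directed cycle with self-loops on the vertices `0, …, N - 1`: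
the entry `(n, l)` is `1` if `l = n`, or `l = n + 1`, or `n` is the last vertex and `l` the
first; all other entries are `0`. -/
def cycleAdj (N : ℕ) : Matrix (Fin N) (Fin N) ℂ :=
  Matrix.of fun n l =>
    if l = n ∨ l.val = n.val + 1 ∨ (n.val + 1 = N ∧ l.val = 0) then 1 else 0

/-- `T = A_d A_{d-1} ⋯ A_1` with all factors in `spr(P)`; here `A i` is the `(i + 1)`-st factor
`A_{i+1}`. -/
def FactorsThrough {N : ℕ} (P : Matrix (Fin N) (Fin N) ℂ) (d : ℕ)
    (T : Matrix (Fin N) (Fin N) ℂ) : Prop :=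
  ∃ A : Fin d → Matrix (Fin N) (Fin N) ℂ,
    (∀ i, A i ∈ spr P) ∧ T = (List.ofFn A).reverse.prod

/-- `T` is computable in `d` distributed steps on the network with adjacency matrix `P`: there
are weight matrices `A_1, …, A_d` in `spr(P)` such that every run
`z(k) = A_k z(k-1)`, `k = 1, …, d`, from whatever initial state `z(0)`, ends in
`z(d) = T z(0)`. -/
def IsFiniteTimeComputable {N : ℕ} (P : Matrix (Fin N) (Fin N) ℂ) (d : ℕ)
    (T : Matrix (Fin N) (Fin N) ℂ) : Prop :=
  ∃ A : Fin d → Matrix (Fin N) (Fin N) ℂ,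
    (∀ i, A i ∈ spr P) ∧
      ∀ z : Fin (d + 1) → Fin N → ℂ,
        (∀ k : Fin d, z k.succ = Matrix.mulVec (A k) (z k.castSucc)) →
          z (Fin.last d) = Matrix.mulVec T (z 0)

/-- `p` holds for almost all complex `N × N` matrices: the set where it fails has a closure that
is nowhere dense and of Lebesgue measure zero. (`Matrix.of` identifies `Fin N → Fin N → ℂ`, which
carries the Lebesgue measure `volume`, with the space of matrices.) -/
def ForAlmostAllMatrices {N : ℕ} (p : Matrix (Fin N) (Fin N) ℂ → Prop) : Prop :=
  IsNowhereDense (closure {T : Matrix (Fin N) (Fin N) ℂ | ¬ p T}) ∧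
    (volume : Measure (Fin N → Fin N → ℂ))
      (Matrix.of ⁻¹' closure {T : Matrix (Fin N) (Fin N) ℂ | ¬ p T}) = 0

/-!
Almost every `T` is a product `A_{N-1} ⋯ A_0` of matrices of the shape `A_k = diag(d_k) + c_k P`,
where `P` is the permutation matrix of the `N`-cycle and the scalars `c_k = k + 1` are fixed once
and for all. Only the `N²` entries of the diagonals `d_k` vary, so the product is a polynomial map
from `ℂ^{N²}` to the `N²`-dimensional space of matrices; it suffices that this map is dominant.

Dominance is checked on the derivative at `d = 1`, that is, at `A_k = 1 + c_k P`
(`range_descProdDeriv_eq_top`). Put `q_k = A_{k-1} ⋯ A_0`, let `𝒟` be the space of diagonal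
matrices and `W_m` the range of the derivative of the product of the first `m` factors, so that
`W_{m+1} = A_m W_m + 𝒟 q_m`. For `k < m`, every diagonal `D` satisfies
`D q_k ∈ 𝒟 q_{k+1} + A_m 𝒟 q_k`: since `q_{k+1} = (1 + c_k P) q_k` and `P` permutes the entries of
diagonals, this amounts to solving `D = E - (c_m / c_k) σ(E)` for a diagonal `E`, where `σ` is the
cyclic shift; this is possible because `|c_m / c_k| > 1` and `σ` is an isometry of the sup norm
(`exists_sub_smul_comp_eq`). Hence `𝒟 q_k ⊆ W_N` for all `k < N`
(`diagonal_mul_descProd_mem_range`), and taking differences `q_{k+1} - q_k = c_k P q_k` repeatedly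
gives `𝒟 P^j ⊆ W_N` for all `j < N`. These spaces together span all matrices, because the cycle
acts transitively through its powers `P^j`, `j < N`.

By the inverse function theorem the image of the product map therefore has an interior point. A
nonzero polynomial cannot vanish on an open set, so the comorphism of the product map is injective,
and by Chevalley's theorem and the Nullstellensatz the image contains the complement of the zero
locus of a nonzero polynomial (`MvPolynomial.exists_ne_zero_forall_exists_eval_eq`). Such a zero
locus is closed and Lebesgue null, because lines through a point off the locus meet it in finite
sets (`MvPolynomial.volume_setOf_eval_uncurry_eq_zero`); being null, it has empty interior.
-/

open Matrix Topology

/-! ### Images of dominant polynomial maps -/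

/-- A constructible subset of the spectrum of a domain that contains the generic point contains a
nonempty basic open set. -/
theorem PrimeSpectrum.exists_basicOpen_subset_of_isConstructible {R : Type*} [CommRing R]
    [IsDomain R] {s : Set (PrimeSpectrum R)} (hs : IsConstructible s) (h : ⊥ ∈ s) :
    ∃ f : R, f ≠ 0 ∧ (PrimeSpectrum.basicOpen f : Set (PrimeSpectrum R)) ⊆ s := by
  obtain ⟨S, rfl⟩ := PrimeSpectrum.exists_constructibleSetData_iff.mpr hs
  simp only [PrimeSpectrum.ConstructibleSetData.toSet, Set.mem_iUnion] at h
  obtain ⟨C, hC, hg, hf⟩ := h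
  have hg' : ∀ i, C.g i = 0 := by
    intro i
    have := hg (Set.mem_range_self i)
    simpa using this
  refine ⟨C.f, fun h0 => hf (by simp [h0]), fun x hx => ?_⟩
  refine Set.mem_biUnion hC ⟨?_, ?_⟩
  · rintro _ ⟨i, rfl⟩
    simp [hg' i]
  · simpa using hx

/-- A polynomial map with injective comorphism, over an algebraically closed field, takes every
value outside the zero locus of some nonzero polynomial. -/
theorem MvPolynomial.exists_ne_zero_forall_exists_eval_eq {K σ τ : Type*} [Field K] [IsAlgClosed K]
    [Finite σ] [Finite τ] (f : σ → MvPolynomial τ K)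
    (hf : Function.Injective (MvPolynomial.aeval f : MvPolynomial σ K →ₐ[K] MvPolynomial τ K)) :
    ∃ p : MvPolynomial σ K, p ≠ 0 ∧
      ∀ y : σ → K, MvPolynomial.eval y p ≠ 0 → ∃ x : τ → K, ∀ i, MvPolynomial.eval x (f i) = y i := by
  set φ : MvPolynomial σ K →ₐ[K] MvPolynomial τ K := MvPolynomial.aeval f with hφ
  have hfp : φ.toRingHom.FinitePresentation := by
    algebraize [φ.toRingHom]
    have : IsScalarTower K (MvPolynomial σ K) (MvPolynomial τ K) :=
      IsScalarTower.of_algebraMap_eq' φ.comp_algebraMap.symm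
    exact Algebra.FinitePresentation.of_restrict_scalars_finitePresentation K _ _
  obtain ⟨p, hp0, hp⟩ := PrimeSpectrum.exists_basicOpen_subset_of_isConstructible
    (PrimeSpectrum.isConstructible_range_comap hfp) ⟨⊥, by
      ext1
      exact (RingHom.injective_iff_ker_eq_bot _).1 hf⟩
  refine ⟨p, hp0, fun y hy => ?_⟩
  obtain ⟨Q, hQ⟩ := @hp (MvPolynomial.pointToPoint (k := K) y) (by
    simpa [MvPolynomial.pointToPoint, MvPolynomial.coe_aeval_eq_eval] using hy)
  -- `Q` lies over the maximal ideal of `y`, hence so does every maximal ideal `M` above `Q`; by the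
  -- Nullstellensatz such an `M` is the ideal of a point `x`.
  obtain ⟨M, hM, hQM⟩ := Q.asIdeal.exists_le_maximal Q.isPrime.ne_top
  obtain ⟨x, rfl⟩ := MvPolynomial.isMaximal_iff_eq_vanishingIdeal_singleton.1 hM
  refine ⟨x, fun i => ?_⟩
  have hmem : MvPolynomial.X i - MvPolynomial.C (y i) ∈
      (PrimeSpectrum.comap φ.toRingHom Q).asIdeal := by
    rw [hQ]
    simp [MvPolynomial.pointToPoint]
  have := hQM hmem
  simpa [MvPolynomial.mem_vanishingIdeal_singleton_iff, hφ, sub_eq_zero,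
    MvPolynomial.coe_aeval_eq_eval] using this

/-! ### Zero loci of polynomials are null -/

/-- A measurable set that meets every line through a fixed point in a countable set is null: by
Fubini, some dilate of it about that point is null. -/
theorem MeasureTheory.Measure.addHaar_eq_zero_of_countable_inter_lines {E : Type*}
    [NormedAddCommGroup E] [NormedSpace ℝ E] [MeasurableSpace E] [BorelSpace E]
    [FiniteDimensional ℝ E] (μ : Measure E) [μ.IsAddHaarMeasure] {s : Set E}
    (hs : MeasurableSet s) (x : E) (h : ∀ y : E, {t : ℝ | x + t • y ∈ s}.Countable) :
    μ s = 0 := by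
  have hm : Measurable fun z : E × ℝ => x + z.2 • z.1 := by fun_prop
  have h1 : ∀ᵐ y ∂μ, ∀ᵐ t : ℝ, x + t • y ∉ s :=
    .of_forall fun y => ((h y).ae_notMem volume)
  rw [Measure.ae_ae_comm (p := fun y t => x + t • y ∉ s) (hm hs).compl] at h1
  obtain ⟨t, ht, ht0⟩ := (h1.and (compl_mem_ae_iff.2 (measure_singleton (0 : ℝ)))).exists
  have ht0 : t ≠ 0 := ht0
  have h2 : μ ((t • ·) ⁻¹' ((x + ·) ⁻¹' s)) = 0 := by
    rw [ae_iff] at ht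
    simp only [not_not] at ht
    exact ht
  rw [Measure.addHaar_preimage_smul _ ht0, measure_preimage_add] at h2
  simpa [ht0] using h2

instance isAddHaarMeasure_volume_pi_pi_complex {ι κ : Type*} [Fintype ι] [Fintype κ] :
    (volume : Measure (ι → κ → ℂ)).IsAddHaarMeasure :=
  have : (volume : Measure (κ → ℂ)).IsAddHaarMeasure := Measure.pi.isAddHaarMeasure _
  Measure.pi.isAddHaarMeasure _

/-- The zero locus of a nonzero polynomial in the entries of a complex matrix is Lebesgue null. -/
theorem MvPolynomial.volume_setOf_eval_uncurry_eq_zero {ι κ : Type*} [Fintype ι] [Fintype κ]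
    {p : MvPolynomial (ι × κ) ℂ} (hp : p ≠ 0) :
    volume {M : ι → κ → ℂ | MvPolynomial.eval (Function.uncurry M) p = 0} = 0 := by
  obtain ⟨x, hx⟩ : ∃ x : ι × κ → ℂ, MvPolynomial.eval x p ≠ 0 := by
    by_contra! h
    exact hp (MvPolynomial.funext fun x => by simp [h])
  have hcl : IsClosed {M : ι → κ → ℂ | MvPolynomial.eval (Function.uncurry M) p = 0} := by
    refine isClosed_eq (p.continuous_eval.comp ?_) continuous_const
    exact continuous_pi fun i => (continuous_apply i.2).comp (continuous_apply i.1)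
  refine Measure.addHaar_eq_zero_of_countable_inter_lines volume hcl.measurableSet
    (Function.curry x) fun y => ?_
  -- The restriction of `p` to the line through `x` in direction `y`; it is nonzero at `0`.
  let q : Polynomial ℂ :=
    MvPolynomial.aeval (fun i => Polynomial.C (x i) + Polynomial.C (y i.1 i.2) * Polynomial.X) p
  have hq : ∀ t : ℂ, q.eval t = MvPolynomial.eval (fun i => x i + y i.1 i.2 * t) p := by
    intro t
    have : q.eval t = Polynomial.aeval t q := by simp
    rw [this, ← AlgHom.comp_apply, MvPolynomial.comp_aeval, ← MvPolynomial.coe_aeval_eq_eval]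
    simp
  have hq0 : q ≠ 0 := by
    intro h
    have := hq 0
    simp [h] at this
    exact hx (by simpa using this.symm)
  have hfin : {t : ℂ | q.IsRoot t}.Finite := Polynomial.finite_setOfPred_isRoot hq0
  refine (hfin.preimage (f := ((↑) : ℝ → ℂ)) Complex.ofReal_injective.injOn).countable.mono ?_
  intro t ht
  simp only [Set.mem_preimage, Set.mem_ofPred_eq, Polynomial.IsRoot, hq] at ht ⊢
  convert ht using 3 with i
  simp [Function.uncurry_def, mul_comm]

/-! ### Products of bidiagonal matrices along a permutation -/

section
variable {ι R : Type*} [Fintype ι] [DecidableEq ι] [CommRing R]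

/-- The matrix `diag(d) + c P`, where `P` is the permutation matrix of `s`, with `P i (s i) = 1`. -/
def permBidiagonal (s : Equiv.Perm ι) (c : R) (d : ι → R) : Matrix ι ι R :=
  diagonal d + c • s.permMatrix R

/-- The product `A (m - 1) * ⋯ * A 1 * A 0` of the first `m` terms of a sequence, later terms
standing on the left. -/
def descProd {R : Type*} [Monoid R] (A : ℕ → R) : ℕ → R
  | 0 => 1
  | m + 1 => A m * descProd A m

theorem prod_reverse_ofFn_eq_descProd {R : Type*} [Monoid R] (A : ℕ → R) (m : ℕ) :
    (List.ofFn fun i : Fin m => A i).reverse.prod = descProd A m := by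
  induction m with
  | zero => simp [descProd]
  | succ m ih =>
    rw [List.ofFn_succ', List.concat_eq_append, List.reverse_append]
    simp [descProd, ← ih]

theorem map_descProd {R S F : Type*} [Monoid R] [Monoid S] [FunLike F R S] [MonoidHomClass F R S]
    (f : F) (A : ℕ → R) (m : ℕ) : f (descProd A m) = descProd (fun k => f (A k)) m := by
  induction m with
  | zero => simp [descProd]
  | succ m ih => simp [descProd, ih]

theorem permMatrix_mul_diagonal (s : Equiv.Perm ι) (d : ι → R) :
    s.permMatrix R * diagonal d = diagonal (d ∘ s) * s.permMatrix R := by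
  ext i j
  rw [mul_diagonal, diagonal_mul]
  by_cases h : s i = j
  · subst h; simp [mul_comm]
  · simp [PEquiv.toMatrix_apply, h]

theorem permMatrix_pow (s : Equiv.Perm ι) (k : ℕ) :
    s.permMatrix R ^ k = (s ^ k).permMatrix R := by
  induction k with
  | zero => simp
  | succ k ih => rw [pow_succ, ih, pow_succ', permMatrix_mul]

theorem map_permBidiagonal {S : Type*} [CommRing S] (f : R →+* S) (s : Equiv.Perm ι) (c : R)
    (d : ι → R) :
    f.mapMatrix (permBidiagonal s c d) = permBidiagonal s (f c) (f ∘ d) := by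
  ext i j
  simp [permBidiagonal, PEquiv.toMatrix_apply, diagonal_apply, apply_ite f]

/-- The derivative of the product `A (m - 1) * ⋯ * A 0` when the factor `A k` is varied by the
diagonal matrix with entries `δ k`, as a linear map of `δ`; only the `δ k` with `k < m` matter. -/
def descProdDeriv (A : ℕ → Matrix ι ι R) :
    ℕ → (ℕ → ι → R) →ₗ[R] Matrix ι ι R
  | 0 => 0
  | m + 1 => LinearMap.mulLeft R (A m) ∘ₗ descProdDeriv A m +
      LinearMap.mulRight R (descProd A m) ∘ₗ diagonalLinearMap ι R R ∘ₗ LinearMap.proj m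

theorem descProdDeriv_succ (A : ℕ → Matrix ι ι R) (m : ℕ) (δ : ℕ → ι → R) :
    descProdDeriv A (m + 1) δ = A m * descProdDeriv A m δ + diagonal (δ m) * descProd A m := rfl

theorem descProdDeriv_congr (A : ℕ → Matrix ι ι R) {m : ℕ} {δ ε : ℕ → ι → R}
    (h : ∀ k < m, δ k = ε k) : descProdDeriv A m δ = descProdDeriv A m ε := by
  induction m with
  | zero => rfl
  | succ m ih =>
    rw [descProdDeriv_succ, descProdDeriv_succ, ih fun k hk => h k (by omega), h m (by omega)]

theorem mul_add_diagonal_mul_mem_range_descProdDeriv (A : ℕ → Matrix ι ι R) {m : ℕ}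
    {M : Matrix ι ι R} (hM : M ∈ (descProdDeriv A m).range) (d : ι → R) :
    A m * M + diagonal d * descProd A m ∈ (descProdDeriv A (m + 1)).range := by
  obtain ⟨δ, rfl⟩ := hM
  refine ⟨Function.update δ m d, ?_⟩
  rw [descProdDeriv_succ, Function.update_self,
    descProdDeriv_congr A fun k hk => Function.update_of_ne hk.ne _ _]
end

/-- The operator `1 - r σ`, with `σ` a permutation of coordinates and `|r| > 1`, is surjective: it is
injective since `σ` preserves the sup norm. -/
theorem exists_sub_smul_comp_eq {ι : Type*} [Finite ι] (s : Equiv.Perm ι) {r : ℂ} (hr : 1 < ‖r‖)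
    (d : ι → ℂ) : ∃ e : ι → ℂ, e - r • (e ∘ s) = d := by
  let f : (ι → ℂ) →ₗ[ℂ] (ι → ℂ) := LinearMap.id - r • LinearMap.funLeft ℂ ℂ s
  suffices h : Function.Injective f by
    exact LinearMap.injective_iff_surjective.1 h d
  rw [injective_iff_map_eq_zero]
  intro e he
  have h1 : ∀ i, e i = r * e (s i) := fun i => by
    have := congrFun he i
    simpa [f, sub_eq_zero, LinearMap.funLeft_apply] using this
  rcases isEmpty_or_nonempty ι with _ | _
  · exact Subsingleton.elim _ _
  obtain ⟨n, hn⟩ := Finite.exists_max fun i => ‖e i‖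
  have h2 : ‖r‖ * ‖e n‖ ≤ ‖e n‖ := by
    have := hn (s.symm n)
    rwa [h1, norm_mul, s.apply_symm_apply] at this
  have h3 : ‖e n‖ = 0 := by nlinarith [norm_nonneg (e n)]
  ext i
  simpa [h3] using hn i

section
variable {ι : Type*} [Fintype ι] [DecidableEq ι]

/-- At the base point `A k = 1 + c k • P`, the range of the derivative of the product of `m` factors
contains `D * (A (k - 1) * ⋯ * A 0)` for every diagonal `D` and every `k < m`. The induction on `m`
runs downwards through `k`, from `k = m - 1`. -/
theorem diagonal_mul_descProd_mem_range (s : Equiv.Perm ι) {c : ℕ → ℂ} (hc0 : ∀ k, c k ≠ 0)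
    (hc : ∀ k m, k < m → ‖c k‖ < ‖c m‖) (m : ℕ) :
    ∀ k < m, ∀ d : ι → ℂ, diagonal d * descProd (fun k => permBidiagonal s (c k) 1) k ∈
      (descProdDeriv (fun k => permBidiagonal s (c k) (1 : ι → ℂ)) m).range := by
  set A := fun k => permBidiagonal s (c k) (1 : ι → ℂ) with hA
  induction m with
  | zero => simp
  | succ m ih =>
    intro k hk
    induction Nat.le_of_lt_succ hk using Nat.decreasingInduction with
    | self =>
      intro d
      simpa using mul_add_diagonal_mul_mem_range_descProdDeriv A (Submodule.zero_mem _) d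
    | of_succ k hkm ihk =>
      intro d
      -- `(e - r • e ∘ s) q_k` is the sum of `A_m (e q_k)` and `(-r • e ∘ s) q_{k+1}`.
      set r : ℂ := c m / c k with hr
      have hrk : c m = r * c k := (div_mul_cancel₀ _ (hc0 k)).symm
      obtain ⟨e, rfl⟩ := exists_sub_smul_comp_eq s (r := r) (by
        rw [hr, norm_div, one_lt_div (norm_pos_iff.2 (hc0 k))]
        exact hc k m hkm) d
      have h1 := mul_add_diagonal_mul_mem_range_descProdDeriv A (ih k hkm e) 0
      have h2 := ihk (by omega) (-r • (e ∘ s))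
      convert Submodule.add_mem _ h1 h2 using 1
      have h3 : A m * (diagonal e * descProd A k) =
          diagonal e * descProd A k + c m • (diagonal (e ∘ s) * (s.permMatrix ℂ * descProd A k)) := by
        simp only [hA, permBidiagonal, diagonal_one', add_mul, smul_mul_assoc, one_mul,
          ← mul_assoc, permMatrix_mul_diagonal]
      have h4 : descProd A (k + 1) = descProd A k + c k • (s.permMatrix ℂ * descProd A k) := by
        simp [descProd, hA, permBidiagonal, add_mul, diagonal_one']
      have h5 : diagonal (e - r • (e ∘ s)) = diagonal e - r • diagonal (e ∘ s) := by
        rw [← diagonal_smul]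
        exact (diagonal_sub _ _).symm
      rw [h3, h4, h5, hrk, diagonal_smul, diagonal_zero', zero_mul]
      simp only [mul_add, sub_mul, smul_mul_assoc, mul_smul_comm]
      module

/-- The derivative of the product of `N` bidiagonal factors with respect to their diagonals is
surjective at `d = 1`, if any index is carried to any other by one of the first `N` powers of `s`. -/
theorem range_descProdDeriv_eq_top {N : ℕ} (s : Equiv.Perm ι) (hs : ∀ i j, ∃ k < N, (s ^ k) i = j)
    {c : ℕ → ℂ} (hc0 : ∀ k, c k ≠ 0) (hc : ∀ k m, k < m → ‖c k‖ < ‖c m‖) :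
    (descProdDeriv (fun k => permBidiagonal s (c k) (1 : ι → ℂ)) N).range = ⊤ := by
  have h := diagonal_mul_descProd_mem_range s hc0 hc N
  set A := fun k => permBidiagonal s (c k) (1 : ι → ℂ) with hA
  have h1 : ∀ j k, j + k < N → ∀ d : ι → ℂ,
      diagonal d * (s.permMatrix ℂ ^ j * descProd A k) ∈ (descProdDeriv A N).range := by
    -- Multiplication by `P` is gained from `P * q_k = (c k)⁻¹ • (q_{k+1} - q_k)`.
    intro j
    induction j with
    | zero => simpa using fun k hk => h k hk
    | succ j ih =>
      intro k hk d
      have h2 := Submodule.smul_mem _ (c k)⁻¹ <|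
        Submodule.sub_mem _ (ih (k + 1) (by omega) d) (ih k (by omega) d)
      convert h2 using 1
      have h4 : descProd A (k + 1) = descProd A k + c k • (s.permMatrix ℂ * descProd A k) := by
        simp [descProd, hA, permBidiagonal, add_mul, diagonal_one']
      rw [h4, mul_add, mul_add, add_sub_cancel_left, mul_smul_comm, mul_smul_comm, smul_smul,
        inv_mul_cancel₀ (hc0 k), one_smul, pow_succ, mul_assoc]
  rw [eq_top_iff]
  intro M _
  rw [matrix_eq_sum_single M]
  refine Submodule.sum_mem _ fun i _ => Submodule.sum_mem _ fun j _ => ?_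
  obtain ⟨k, hk, rfl⟩ := hs i j
  convert h1 k 0 hk (Pi.single i (M i ((s ^ k) i))) using 1
  ext a b
  rw [permMatrix_pow, descProd, mul_one, diagonal_mul]
  simp [single_apply, PEquiv.toMatrix_apply, Pi.single_apply]
  grind

end

/-! ### Dominance of the product map -/

section
-- The sup norm, whose topology is by definition the one on `ι → ι → ℂ`.
attribute [local instance] Matrix.normedAddCommGroup Matrix.normedSpace

variable {ι : Type*} [Fintype ι] [DecidableEq ι]

/-- The formal derivative `descProdDeriv` is the strict derivative of the product, when the diagonals
`d_k = π k y` depend linearly on a parameter `y`. -/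
theorem hasStrictFDerivAt_descProd {E : Type*} [NormedAddCommGroup E] [NormedSpace ℂ E]
    (s : Equiv.Perm ι) (c : ℕ → ℂ) (π : ℕ → E →L[ℂ] (ι → ℂ)) (x : E) (m : ℕ) :
    ∃ L : E →L[ℂ] Matrix ι ι ℂ,
      (∀ v, L v = descProdDeriv (fun k => permBidiagonal s (c k) (π k x)) m fun k => π k v) ∧
      HasStrictFDerivAt (fun y => descProd (fun k => permBidiagonal s (c k) (π k y)) m) L x := by
  induction m with
  | zero => exact ⟨0, fun v => rfl, hasStrictFDerivAt_const _ _⟩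
  | succ m ih =>
    obtain ⟨L, hL, hd⟩ := ih
    let D : (ι → ℂ) →L[ℂ] Matrix ι ι ℂ := (diagonalLinearMap ι ℂ ℂ).toContinuousLinearMap
    let B : Matrix ι ι ℂ →L[ℂ] Matrix ι ι ℂ →L[ℂ] Matrix ι ι ℂ :=
      (LinearMap.mul ℂ (Matrix ι ι ℂ)).toContinuousBilinearMap
    have hf : HasStrictFDerivAt (fun y => permBidiagonal s (c m) (π m y)) (D ∘L π m) x :=
      (D ∘L π m).hasStrictFDerivAt.add_const _
    refine ⟨_, fun v => ?_, B.hasStrictFDerivAt_of_bilinear hf hd⟩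
    rw [descProdDeriv_succ, ← hL]
    rfl

/-- The set of products of `N` bidiagonal factors has an interior point. The diagonals are indexed by
`Fin (N + 1)`, so that `Fin.ofNat` is available also for `N = 0`; the last one does not enter the
product. -/
theorem nonempty_interior_range_descProd {N : ℕ} (s : Equiv.Perm ι)
    (hs : ∀ i j, ∃ k < N, (s ^ k) i = j) {c : ℕ → ℂ} (hc0 : ∀ k, c k ≠ 0)
    (hc : ∀ k m, k < m → ‖c k‖ < ‖c m‖) :
    (interior {M : ι → ι → ℂ | ∃ d : Fin (N + 1) → ι → ℂ,
      descProd (R := Matrix ι ι ℂ)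
        (fun k => permBidiagonal s (c k) (d (Fin.ofNat (N + 1) k))) N = M}).Nonempty := by
  let π : ℕ → (Fin (N + 1) → ι → ℂ) →L[ℂ] (ι → ℂ) :=
    fun k => ContinuousLinearMap.proj (Fin.ofNat (N + 1) k)
  obtain ⟨L, hL, hd⟩ := hasStrictFDerivAt_descProd s c π 1 N
  have hsurj : L.range = ⊤ := by
    refine LinearMap.range_eq_top.2 fun M => ?_
    obtain ⟨δ, hδ⟩ : M ∈ (descProdDeriv (fun k => permBidiagonal s (c k) (1 : ι → ℂ)) N).range :=
      range_descProdDeriv_eq_top s hs hc0 hc ▸ Submodule.mem_top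
    refine ⟨fun k => δ k, (hL _).trans (Eq.trans ?_ hδ)⟩
    refine descProdDeriv_congr _ fun k hk => ?_
    have : ((Fin.ofNat (N + 1) k : Fin (N + 1)) : ℕ) = k := Nat.mod_eq_of_lt (by omega)
    simp only [π, ContinuousLinearMap.proj_apply, this]
  have hnhds := hd.map_nhds_eq_of_surj hsurj
  refine ⟨_, mem_interior_iff_mem_nhds.2 (hnhds.ge (Filter.mem_map.2 ?_))⟩
  exact Filter.univ_mem' fun d => ⟨d, rfl⟩
end

section
variable {ι : Type*} [Fintype ι] [DecidableEq ι]

/-- All matrices outside the zero locus of some nonzero polynomial are products of `N` bidiagonal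
matrices with prescribed off-diagonal scalars `c k`. -/
theorem exists_ne_zero_forall_exists_descProd_eq {N : ℕ} (s : Equiv.Perm ι)
    (hs : ∀ i j, ∃ k < N, (s ^ k) i = j) {c : ℕ → ℂ} (hc0 : ∀ k, c k ≠ 0)
    (hc : ∀ k m, k < m → ‖c k‖ < ‖c m‖) :
    ∃ p : MvPolynomial (ι × ι) ℂ, p ≠ 0 ∧ ∀ T : Matrix ι ι ℂ,
      MvPolynomial.eval (Function.uncurry T) p ≠ 0 →
        ∃ d : ℕ → ι → ℂ, descProd (fun k => permBidiagonal s (c k) (d k)) N = T := by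
  let f : ι × ι → MvPolynomial (Fin (N + 1) × ι) ℂ := fun ij =>
    descProd (fun k => permBidiagonal s (MvPolynomial.C (c k))
      fun i => MvPolynomial.X (Fin.ofNat (N + 1) k, i)) N ij.1 ij.2
  have hf : ∀ (x : Fin (N + 1) × ι → ℂ) (ij : ι × ι), MvPolynomial.eval x (f ij) =
      descProd (fun k => permBidiagonal s (c k) fun i => x (Fin.ofNat (N + 1) k, i)) N
        ij.1 ij.2 := by
    intro x ij
    have h := map_descProd (MvPolynomial.eval x).mapMatrix (fun k =>
      permBidiagonal s (MvPolynomial.C (c k))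
        fun i => MvPolynomial.X (R := ℂ) (Fin.ofNat (N + 1) k, i)) N
    simp only [map_permBidiagonal, Function.comp_def, MvPolynomial.eval_C,
      MvPolynomial.eval_X] at h
    rw [← h]
    rfl
  obtain ⟨p, hp0, hp⟩ := MvPolynomial.exists_ne_zero_forall_exists_eval_eq f (by
    rw [injective_iff_map_eq_zero]
    intro q hq
    by_contra hq0
    -- A relation `q` among the entries of the product vanishes on a set with interior points,
    -- whereas the zero locus of `q ≠ 0` is null.
    have hnull := MvPolynomial.volume_setOf_eval_uncurry_eq_zero hq0
    refine (nonempty_interior_range_descProd s hs hc0 hc).ne_empty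
      (Measure.interior_eq_empty_of_null (measure_mono_null ?_ hnull))
    rintro M ⟨d, rfl⟩
    have h := congrArg (MvPolynomial.aeval (R := ℂ) (Function.uncurry d)) hq
    rw [← AlgHom.comp_apply, MvPolynomial.comp_aeval, map_zero] at h
    -- `R` is spelled out because `Function.uncurry` expects a function, and functions carry the
    -- entrywise product.
    have hfun : (fun ij => MvPolynomial.aeval (Function.uncurry d) (f ij)) =
        Function.uncurry (descProd (R := Matrix ι ι ℂ)
          (fun k => permBidiagonal s (c k) (d (Fin.ofNat (N + 1) k))) N) :=
      funext fun ij => by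
        rw [MvPolynomial.aeval_eq_eval]
        exact hf (Function.uncurry d) ij
    rwa [hfun, MvPolynomial.aeval_eq_eval] at h)
  refine ⟨p, hp0, fun T hT => ?_⟩
  obtain ⟨x, hx⟩ := hp _ hT
  refine ⟨fun k i => x (Fin.ofNat (N + 1) k, i), ?_⟩
  ext i j
  exact (hf x (i, j)).symm.trans (hx (i, j))
end

/-! ### The directed cycle -/

theorem finRotate_pow_apply (n : ℕ) (k : ℕ) (i : Fin (n + 1)) :
    (finRotate (n + 1) ^ k) i = i + Fin.ofNat (n + 1) k := by
  induction k with
  | zero => simp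
  | succ k ih =>
    rw [pow_succ', Equiv.Perm.mul_apply, ih, finRotate_apply, add_assoc]
    congr 1
    ext
    simp [Fin.val_add]

theorem exists_finRotate_pow_eq {N : ℕ} (i j : Fin N) : ∃ k < N, (finRotate N ^ k) i = j := by
  obtain _ | n := N
  · exact i.elim0
  · exact ⟨(j - i : Fin (n + 1)), Fin.is_lt _, by rw [finRotate_pow_apply]; simp⟩

theorem permBidiagonal_finRotate_mem_spr {N : ℕ} (c : ℂ) (d : Fin N → ℂ) :
    permBidiagonal (finRotate N) c d ∈ spr (cycleAdj N) := by
  intro i j h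
  obtain _ | n := N
  · exact i.elim0
  simp only [cycleAdj, of_apply, ite_eq_right_iff, one_ne_zero, imp_false, not_or] at h
  obtain ⟨h1, h2, h3⟩ := h
  have h4 : finRotate (n + 1) i ≠ j := by
    rintro rfl
    rw [coe_finRotate] at h2 h3
    by_cases hi : i = Fin.last n
    · exact h3 ⟨by simp [hi], by simp [hi]⟩
    · simp [hi] at h2
  have h5 : i + 1 ≠ j := by rwa [finRotate_apply] at h4
  simp [permBidiagonal, diagonal_apply_ne' _ h1, PEquiv.toMatrix_apply, h5]

theorem FactorsThrough.isFiniteTimeComputable {N d : ℕ} {P T : Matrix (Fin N) (Fin N) ℂ}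
    (h : FactorsThrough P d T) : IsFiniteTimeComputable P d T := by
  obtain ⟨A, hA, rfl⟩ := h
  refine ⟨A, hA, ?_⟩
  clear hA
  induction d with
  | zero => intro z _; simp
  | succ d ih =>
    intro z hz
    have h := ih (fun i => A i.castSucc) (fun i => z i.castSucc) fun k => hz k.castSucc
    rw [← Fin.succ_last, hz, h, List.ofFn_succ', List.concat_eq_append, List.reverse_append]
    simp

theorem forAlmostAllMatrices_of_eval_ne_zero {N : ℕ} {P : Matrix (Fin N) (Fin N) ℂ → Prop}
    {p : MvPolynomial (Fin N × Fin N) ℂ} (hp : p ≠ 0)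
    (h : ∀ T : Matrix (Fin N) (Fin N) ℂ, MvPolynomial.eval (Function.uncurry T) p ≠ 0 → P T) :
    ForAlmostAllMatrices P := by
  have hcl : IsClosed {T : Matrix (Fin N) (Fin N) ℂ |
      MvPolynomial.eval (Function.uncurry T) p = 0} := by
    refine isClosed_eq (p.continuous_eval.comp ?_) continuous_const
    exact continuous_pi fun i => continuous_id.matrix_elem i.1 i.2
  have hsub : closure {T | ¬ P T} ⊆ {T : Matrix (Fin N) (Fin N) ℂ |
      MvPolynomial.eval (Function.uncurry T) p = 0} :=
    hcl.closure_subset_iff.2 fun T hT => by_contra fun h0 => hT (h T h0)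
  have hnull : (volume : Measure (Fin N → Fin N → ℂ))
      (Matrix.of ⁻¹' closure {T : Matrix (Fin N) (Fin N) ℂ | ¬ P T}) = 0 :=
    measure_mono_null (fun T hT => hsub hT) (MvPolynomial.volume_setOf_eval_uncurry_eq_zero hp)
  refine ⟨?_, hnull⟩
  rw [IsNowhereDense, closure_closure]
  exact Measure.interior_eq_empty_of_null (X := Fin N → Fin N → ℂ) hnull

theorem mainTheorem2 (N : ℕ) :
    ForAlmostAllMatrices (FactorsThrough (cycleAdj N) N) ∧
      ForAlmostAllMatrices (IsFiniteTimeComputable (cycleAdj N) N) := by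
  obtain ⟨p, hp0, hp⟩ := exists_ne_zero_forall_exists_descProd_eq (finRotate N)
    exists_finRotate_pow_eq (c := fun k => (k : ℂ) + 1) (fun k => Nat.cast_add_one_ne_zero k)
    (fun k m hkm => by
      simp only [← Nat.cast_add_one, Complex.norm_natCast]
      exact_mod_cast Nat.succ_lt_succ hkm)
  have h : ∀ T : Matrix (Fin N) (Fin N) ℂ, MvPolynomial.eval (Function.uncurry T) p ≠ 0 →
      FactorsThrough (cycleAdj N) N T := by
    intro T hT
    obtain ⟨d, rfl⟩ := hp T hT
    exact ⟨_, fun i => permBidiagonal_finRotate_mem_spr _ _, (prod_reverse_ofFn_eq_descProd _ N).symm⟩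
  exact ⟨forAlmostAllMatrices_of_eval_ne_zero hp0 h,
    forAlmostAllMatrices_of_eval_ne_zero hp0 fun T hT => (h T hT).isFiniteTimeComputable⟩
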